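/- Let $P$ be a set of atomic propositions with a distinguished $\kappa\in P$, and let $\mathrm{Var}$ be a set of variables. cPLTL formulas are given by $\varphi ::= p \mid \neg p \mid \varphi\wedge\varphi \mid \varphi\vee\varphi \mid \mathbf{X}\varphi \mid \varphi\mathbf{U}\varphi \mid \varphi\mathbf{R}\varphi \mid \mathbf{F}_{\le z}\varphi \mid \mathbf{G}_{\le z}\varphi$ with $p\in P$, $z\in\mathrm{Var}$. The size $|\varphi|$ is the number of distinct subformulas of $\varphi$ (where $\neg p$ counts as atomic), and $\varphi$ is well-formed if no variable parameterizes both an operator $\mathbf{F}_{\le z}$ and an operator $\mathbf{G}_{\le z}$ in $\varphi$. A cost-trace is a sequence $w = w_0c_0w_1c_1\cdots$ with $w_n\subseteq P$, $c_n\in\mathbb{N}$, such that $c_n>0$ if and only if $\kappa\in w_{n+1}$, for all $n$. For a valuation $\alpha\colon\mathrm{Var}\to\mathbb{N}$, the relation $(w,n,\alpha)\models\varphi$ is defined as in LTL for atomic formulas, Boolean connectives, next ($\mathbf X$), until ($\mathbf U$) and release ($\mathbf R$). Moreover, $(w,n,\alpha)\models\mathbf{F}_{\le z}\varphi$ if and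 only if there is $j\ge 0$ with $\sum_{i=0}^{j-1}c_{n+i}\le\alpha(z)$ and $(w,n+j,\alpha)\models\varphi$, and $(w,n,\alpha)\models\mathbf{G}_{\le z}\varphi$ if and only if $(w,n+j,\alpha)\models\varphi$ for every $j\ge 0$ with $\sum_{i=0}^{j-1}c_{n+i}\le\alpha(z)$. A transition system $\mathcal{S}=(S,s_I,E,\ell,\mathrm{cst})$ consists of a finite directed graph $(S,E)$ in which every state has a successor, an initial state $s_I\in S$, a labeling $\ell\colon S\to 2^P$ and a cost function $\mathrm{cst}\colon E\to\mathbb{N}$ such that, for every edge $(v,v')\in E$, $\mathrm{cst}(v,v')>0$ if and only if $\kappa\in\ell(v')$. It satisfies $\varphi$ with respect to $\alpha$ if, for every infinite path $s_0s_1s_2\cdots$ with $s_0=s_I$, the cost-trace $w=\ell(s_0)\,\mathrm{cst}(s_0,s_1)\,\ell(s_1)\,\mathrm{cst}(s_1,s_2)\cdots$ fulfils $(w,0,\alpha)\models\varphi$. Statement: there is a constant $C\in\mathbb{N}$ (depending on nothing) such that, for every transition system $\mathcal{S}$ and every well-formed cPLTL formula $\varphi$: if $\mathcal{S}$ satisfies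 $\varphi$ with respect to some valuation, then $\mathcal{S}$ satisfies $\varphi$ with respect to a valuation $\beta$ with $$\beta(z)\le 2^{C\cdot|\varphi|}\cdot|S|\cdot W\qquad\text{for every } z\in\mathrm{Var},$$ where $W=\max_{e\in E}\mathrm{cst}(e)$ is the maximal cost in $\mathcal{S}$. -/

import Mathlib

/-- Formulas of parametric LTL with costs (cPLTL), in negation normal form, over atomic
propositions `P` and variables `V`. -/
inductive CPLTL (P V : Type*) where
  | atom (p : P)
  | natom (p : P)
  | and (φ ψ : CPLTL P V)
  | or (φ ψ : CPLTL P V)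
  | next (φ : CPLTL P V)
  | untl (φ ψ : CPLTL P V)
  | rel (φ ψ : CPLTL P V)
  | evt (z : V) (φ : CPLTL P V)
  | alw (z : V) (φ : CPLTL P V)

namespace CPLTL

/-- The set `cl φ` of subformulas of `φ` (including `φ`). -/
def cl {P V : Type*} : CPLTL P V → Set (CPLTL P V)
  | atom p => {atom p}
  | natom p => {natom p}
  | and φ ψ => insert (and φ ψ) (cl φ ∪ cl ψ)
  | or φ ψ => insert (or φ ψ) (cl φ ∪ cl ψ)
  | next φ => insert (next φ) (cl φ)
  | untl φ ψ => insert (untl φ ψ) (cl φ ∪ cl ψ)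
  | rel φ ψ => insert (rel φ ψ) (cl φ ∪ cl ψ)
  | evt z φ => insert (evt z φ) (cl φ)
  | alw z φ => insert (alw z φ) (cl φ)

theorem cl_finite {P V : Type*} (φ : CPLTL P V) : φ.cl.Finite := by
  induction φ with
  | atom p => exact Set.finite_singleton _
  | natom p => exact Set.finite_singleton _
  | and φ ψ h₁ h₂ => exact (h₁.union h₂).insert _
  | or φ ψ h₁ h₂ => exact (h₁.union h₂).insert _
  | next φ h => exact h.insert _
  | untl φ ψ h₁ h₂ => exact (h₁.union h₂).insert _
  | rel φ ψ h₁ h₂ => exact (h₁.union h₂).insert _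
  | evt z φ h => exact h.insert _
  | alw z φ h => exact h.insert _

/-- The size of a formula is the number of its distinct subformulas; the set `cl φ` is finite
by `cl_finite`. -/
noncomputable def size {P V : Type*} (φ : CPLTL P V) : ℕ := φ.cl.ncard

/-- Variables that parameterize eventually operators in `φ`. -/
def varF {P V : Type*} (φ : CPLTL P V) : Set V := {z | ∃ ψ, evt z ψ ∈ φ.cl}

/-- Variables that parameterize always operators in `φ`. -/
def varG {P V : Type*} (φ : CPLTL P V) : Set V := {z | ∃ ψ, alw z ψ ∈ φ.cl}

/-- No variable parameterizes both an eventually and an always operator. -/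
def WellFormed {P V : Type*} (φ : CPLTL P V) : Prop := φ.varF ∩ φ.varG = ∅

end CPLTL

/-- A cost-trace `w₀ c₀ w₁ c₁ ⋯`, where the distinguished proposition `κ` holds at a position
exactly if the step that leads to it has non-zero cost. -/
structure CostTrace (P : Type*) (κ : P) where
  label : ℕ → Set P
  cost : ℕ → ℕ
  cost_pos_iff : ∀ j, 0 < cost j ↔ κ ∈ label (j + 1)

/-- The cost of the infix `w_n c_n ⋯ c_{n+j-1} w_{n+j}`. -/
def CostTrace.infixCost {P : Type*} {κ : P} (w : CostTrace P κ) (n j : ℕ) : ℕ :=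
  ∑ i ∈ Finset.range j, w.cost (n + i)

/-- The model relation `(w, n, α) ⊨ φ`. -/
def CPLTL.Sat {P V : Type*} {κ : P} (w : CostTrace P κ) (α : V → ℕ) : ℕ → CPLTL P V → Prop
  | n, .atom p => p ∈ w.label n
  | n, .natom p => p ∉ w.label n
  | n, .and φ ψ => Sat w α n φ ∧ Sat w α n ψ
  | n, .or φ ψ => Sat w α n φ ∨ Sat w α n ψ
  | n, .next φ => Sat w α (n + 1) φ
  | n, .untl φ ψ => ∃ j, Sat w α (n + j) ψ ∧ ∀ k < j, Sat w α (n + k) φ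
  | n, .rel φ ψ => ∀ j, Sat w α (n + j) ψ ∨ ∃ k < j, Sat w α (n + k) φ
  | n, .evt z φ => ∃ j, w.infixCost n j ≤ α z ∧ Sat w α (n + j) φ
  | n, .alw z φ => ∀ j, w.infixCost n j ≤ α z → Sat w α (n + j) φ

/-- A transition system with costs on the set of states `S` (assumed to be finite where it is
used), in which every state has a successor and `κ` indicates the sign of the cost of each edge
leading to a state. -/
structure TransitionSystem (P : Type*) (κ : P) (S : Type*) where
  init : S
  edges : Set (S × S)
  label : S → Set P
  cost : edges → ℕ
  exists_succ : ∀ s, ∃ t, (s, t) ∈ edges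
  cost_pos_iff : ∀ e : edges, 0 < cost e ↔ κ ∈ label e.1.2

namespace TransitionSystem

/-- A path through the transition system, starting in the initial state. -/
structure Path {P : Type*} {κ : P} {S : Type*} (T : TransitionSystem P κ S) where
  state : ℕ → S
  state_zero : state 0 = T.init
  step : ∀ n, (state n, state (n + 1)) ∈ T.edges

/-- The cost-trace of a path. -/
def Path.trace {P : Type*} {κ : P} {S : Type*} {T : TransitionSystem P κ S} (π : T.Path) :
    CostTrace P κ where
  label n := T.label (π.state n)
  cost n := T.cost ⟨(π.state n, π.state (n + 1)), π.step n⟩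
  cost_pos_iff n := T.cost_pos_iff ⟨(π.state n, π.state (n + 1)), π.step n⟩

/-- The transition system satisfies `φ` with respect to `α`: the trace of every path does. -/
def Satisfies {P V : Type*} {κ : P} {S : Type*} (T : TransitionSystem P κ S)
    (φ : CPLTL P V) (α : V → ℕ) : Prop :=
  ∀ π : T.Path, CPLTL.Sat π.trace α 0 φ

/-- The maximal cost of an edge (a genuine maximum, as `S` is finite and there is an edge). -/
noncomputable def maxCost {P : Type*} {κ : P} {S : Type*} (T : TransitionSystem P κ S) : ℕ :=
  ⨆ e : T.edges, T.cost e

theorem cost_le_maxCost {P : Type*} {κ : P} {S : Type*} [Finite S] (T : TransitionSystem P κ S)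
    (e : T.edges) : T.cost e ≤ T.maxCost :=
  le_ciSup (Set.finite_range T.cost).bddAbove e

end TransitionSystem

/-! Let `β` be zero on the variables of always operators and the claimed bound `N` elsewhere. Fix a
path and cut it into blocks of `M` positive-cost steps, with `M` exceeding the number of codes
(state plus three truth bits, evaluated under `β`, per subformula). By pigeonhole each complete
block contains a loop of positive cost; repeating it `k` more times, with `k` bounding `α` on the
eventually variables, gives another path of the system (`exists_pumping`). That path satisfies the
formula under `α`. `sat_of_sat_pumped` carries this back to the original path under `β`: a bounded
eventuality met at cost at most `k` cannot skip a pumped block, so it is met in the current or the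
next block, at cost at most `2 * M * W` before pumping. The codes keep truth values intact across
jumps. -/

/-! ### Cost blocks and repetitions -/

/-- The number of the block containing position `n`, where a block consists of `M` steps of
positive cost (and all steps of cost zero in between). -/
def costBlock (c : ℕ → ℕ) (M n : ℕ) : ℕ := Nat.count (fun i => 0 < c i) n / M

theorem costBlock_mono (c : ℕ → ℕ) (M : ℕ) : Monotone (costBlock c M) :=
  fun _ _ h => Nat.div_le_div_right (Nat.count_monotone _ h)

theorem costBlock_succ_le (c : ℕ → ℕ) {M : ℕ} (hM : 0 < M) (n : ℕ) :
    costBlock c M (n + 1) ≤ costBlock c M n + 1 := by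
  unfold costBlock
  rw [← Nat.add_div_right _ hM]
  apply Nat.div_le_div_right
  rw [Nat.count_succ]
  split_ifs <;> omega

theorem exists_count_eq (p : ℕ → Prop) [DecidablePred p] {v y : ℕ} (h : v ≤ Nat.count p y) :
    ∃ x, Nat.count p x = v := by
  induction y with
  | zero => exact ⟨0, by simp at h ⊢; omega⟩
  | succ y ih =>
    by_cases hv : v ≤ Nat.count p y
    · exact ih hv
    · refine ⟨y + 1, ?_⟩
      rw [Nat.count_succ] at h ⊢
      split_ifs at h ⊢ <;> omega

/-- Every complete block contains two positions with the same code and a step of positive cost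
between them. -/
theorem exists_repetition {X : Type*} [Finite X] (c : ℕ → ℕ) (code : ℕ → X) {M : ℕ}
    (hM : Nat.card X < M) {b y : ℕ} (hy : b < costBlock c M y) :
    ∃ p q, costBlock c M p = b ∧ costBlock c M q = b ∧ p < q ∧
      Nat.count (fun i => 0 < c i) p < Nat.count (fun i => 0 < c i) q ∧ code p = code q := by
  have hM0 : 0 < M := by omega
  have h1 : (b + 1) * M ≤ Nat.count (fun i => 0 < c i) y := (Nat.le_div_iff_mul_le hM0).1 hy
  have hpos : ∀ i : Fin M, ∃ x, Nat.count (fun i => 0 < c i) x = b * M + i := fun i =>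
    exists_count_eq _ (y := y) (by have := i.2; rw [Nat.add_mul] at h1; omega)
  choose pos hpos using hpos
  have hninj : ¬ Function.Injective (fun i => code (pos i)) := fun h => by
    have := Nat.card_le_card_of_injective _ h
    rw [Nat.card_fin] at this
    omega
  have hblock : ∀ i, costBlock c M (pos i) = b := fun i => by
    unfold costBlock
    rw [hpos, Nat.mul_comm, Nat.mul_add_div hM0, Nat.div_eq_of_lt i.2, Nat.add_zero]
  have key : ∀ i j : Fin M, i < j → code (pos i) = code (pos j) → ∃ p q, costBlock c M p = b ∧
      costBlock c M q = b ∧ p < q ∧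
      Nat.count (fun i => 0 < c i) p < Nat.count (fun i => 0 < c i) q ∧ code p = code q := by
    intro i j hij hc
    have hlt : Nat.count (fun i => 0 < c i) (pos i) < Nat.count (fun i => 0 < c i) (pos j) := by
      rw [hpos, hpos]
      exact Nat.add_lt_add_left hij _
    exact ⟨pos i, pos j, hblock i, hblock j, (Nat.count_monotone _).reflect_lt hlt, hlt, hc⟩
  simp only [Function.Injective, not_forall] at hninj
  obtain ⟨i, j, hc, hij⟩ := hninj
  rcases lt_or_gt_of_ne hij with h | h
  · exact key i j h hc
  · exact key j i h hc.symm

/-! ### Pumping -/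

/-- Walks through `ℕ`, but repeats the loop from `p b` to `q b` in each block `b` another `k`
times. The second component counts the repetitions in the current block. -/
def pumpState (block p q : ℕ → ℕ) (k : ℕ) : ℕ → ℕ × ℕ
  | 0 => (0, 0)
  | n + 1 =>
    let s := pumpState block p q k n
    if s.1 + 1 = q (block s.1) ∧ s.2 < k then (p (block s.1), s.2 + 1)
    else (s.1 + 1, if block (s.1 + 1) = block s.1 then s.2 else 0)

theorem pumpState_snd_le (block p q : ℕ → ℕ) (k n : ℕ) : (pumpState block p q k n).2 ≤ k := by
  induction n with
  | zero => simp [pumpState]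
  | succ n ih =>
    simp only [pumpState]
    split_ifs with h h' <;> simp <;> omega

/-- Here `f` sends a pumped position to its original. Backward jumps preserve code and block, and
passing a whole block costs more than `k`. -/
theorem exists_pumping {X : Type*} [Finite X] (c : ℕ → ℕ) (code : ℕ → X) {M : ℕ}
    (hM : Nat.card X < M) (k : ℕ) :
    ∃ f : ℕ → ℕ, f 0 = 0 ∧ (∀ n, f (n + 1) ≤ f n + 1) ∧
      (∀ n, code (f (n + 1)) = code (f n + 1)) ∧
      (∀ n, costBlock c M (f (n + 1)) = costBlock c M (f n + 1)) ∧ (∀ B, ∃ n, B < f n) ∧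
      ∀ n j, costBlock c M (f n) + 2 ≤ costBlock c M (f (n + j)) →
        k < ∑ i ∈ Finset.range j, c (f (n + i)) := by
  have hM0 : 0 < M := by omega
  have hpq : ∀ b, ∃ p q, (costBlock c M p = b ∧ costBlock c M q = b ∧ p < q ∧
      Nat.count (fun i => 0 < c i) p < Nat.count (fun i => 0 < c i) q ∧ code p = code q) ∨
      -- With `q = 0` the jump test never succeeds, so an incomplete last block is not pumped.
      (q = 0 ∧ ∀ y, costBlock c M y ≤ b) := by
    intro b
    by_cases h : ∃ y, b < costBlock c M y
    · obtain ⟨y, hy⟩ := h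
      obtain ⟨p, q, h⟩ := exists_repetition c code hM hy
      exact ⟨p, q, Or.inl h⟩
    · push Not at h
      exact ⟨0, 0, Or.inr ⟨rfl, h⟩⟩
  choose p q hpq using hpq
  set s := pumpState (costBlock c M) p q k with hs
  have hmono := costBlock_mono c M
  have hstep : ∀ n, ((s n).1 + 1 = q (costBlock c M (s n).1) ∧ (s n).2 < k ∧
      costBlock c M (p (costBlock c M (s n).1)) = costBlock c M (s n).1 ∧
      costBlock c M ((s n).1 + 1) = costBlock c M (s n).1 ∧
      p (costBlock c M (s n).1) < (s n).1 + 1 ∧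
      Nat.count (fun i => 0 < c i) (p (costBlock c M (s n).1)) <
        Nat.count (fun i => 0 < c i) ((s n).1 + 1) ∧
      code (p (costBlock c M (s n).1)) = code ((s n).1 + 1) ∧
      (s (n + 1)).1 = p (costBlock c M (s n).1) ∧ (s (n + 1)).2 = (s n).2 + 1) ∨
      (((s n).1 + 1 = q (costBlock c M (s n).1) → (s n).2 = k) ∧ (s (n + 1)).1 = (s n).1 + 1 ∧
        (costBlock c M ((s n).1 + 1) = costBlock c M (s n).1 → (s (n + 1)).2 = (s n).2) ∧
        (costBlock c M ((s n).1 + 1) ≠ costBlock c M (s n).1 → (s (n + 1)).2 = 0)) := by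
    intro n
    have hle : (s n).2 ≤ k := pumpState_snd_le _ _ _ _ _
    have hsn : s (n + 1) = if (s n).1 + 1 = q (costBlock c M (s n).1) ∧ (s n).2 < k then
        (p (costBlock c M (s n).1), (s n).2 + 1) else ((s n).1 + 1,
        if costBlock c M ((s n).1 + 1) = costBlock c M (s n).1 then (s n).2 else 0) := rfl
    by_cases h : (s n).1 + 1 = q (costBlock c M (s n).1) ∧ (s n).2 < k
    · left
      rw [if_pos h] at hsn
      rcases hpq (costBlock c M (s n).1) with ⟨h1, h2, h3, h4, h5⟩ | ⟨h1, -⟩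
      · rw [← h.1] at h2 h3 h4 h5
        exact ⟨h.1, h.2, h1, h2, h3, h4, h5, by rw [hsn], by rw [hsn]⟩
      · omega
    · right
      rw [if_neg h] at hsn
      refine ⟨fun h' => by by_contra h''; exact h ⟨h', by omega⟩, by rw [hsn], fun h' => ?_,
        fun h' => ?_⟩
      · rw [hsn, if_pos h']
      · rw [hsn, if_neg h']
  refine ⟨fun n => (s n).1, rfl, fun n => ?_, fun n => ?_, fun n => ?_, fun B => ?_, ?_⟩
  · rcases hstep n with h | h <;> simp only <;> omega
  · rcases hstep n with ⟨-, -, -, -, -, -, h, h', -⟩ | ⟨-, h, -⟩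
    · simp only [h', h]
    · simp only [h]
  · rcases hstep n with ⟨-, -, h1, h2, -, -, -, h, -⟩ | ⟨-, h, -⟩
    · simp only [h, h1, h2]
    · simp only [h]
  · by_contra! hB
    -- If positions stayed below `B`, the triple (block, counter, position) would increase
    -- lexicographically forever, yet it would be bounded.
    have hsm : StrictMono (fun n => (costBlock c M (s n).1 * (k + 1) + (s n).2) * (B + 1) +
        (s n).1) := by
      have hlex : ∀ u v x y : ℕ, x ≤ B → u < v → u * (B + 1) + x < v * (B + 1) + y := by
        intro u v x y hx huv
        have := Nat.mul_le_mul_right (B + 1) (Nat.succ_le_of_lt huv)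
        rw [Nat.succ_mul] at this
        omega
      refine strictMono_nat_of_lt_succ fun n => ?_
      rcases hstep n with ⟨-, -, h1, -, -, -, -, h, h'⟩ | ⟨-, h, h', h''⟩
      · refine hlex _ _ _ _ (hB n) ?_
        rw [h, h', h1]
        omega
      · by_cases hb : costBlock c M ((s n).1 + 1) = costBlock c M (s n).1
        · rw [h, h' hb, hb]
          omega
        · refine hlex _ _ _ _ (hB n) ?_
          have h2 : costBlock c M (s n).1 ≤ costBlock c M ((s n).1 + 1) := hmono (Nat.le_succ _)
          have h3 : costBlock c M (s n).1 + 1 ≤ costBlock c M (s (n + 1)).1 := by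
            rw [h]
            omega
          have h4 : (s n).2 ≤ k := pumpState_snd_le _ _ _ _ _
          have := Nat.mul_le_mul_right (k + 1) h3
          rw [Nat.succ_mul] at this
          omega
    set R := (costBlock c M B * (k + 1) + k) * (B + 1) + B with hR
    have h1 := hsm.le_apply (x := R + 1)
    have h2 : (costBlock c M (s (R + 1)).1 * (k + 1) + (s (R + 1)).2) * (B + 1) +
        (s (R + 1)).1 ≤ R := by
      have := hB (R + 1)
      have h3 := hmono this
      have h4 : (s (R + 1)).2 ≤ k := pumpState_snd_le _ _ _ _ _
      rw [hR]
      gcongr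
    omega
  · intro n j hj
    beta_reduce at hj ⊢
    set b := costBlock c M (s n).1 + 1 with hbdef
    rcases hpq b with ⟨e1, e2, e3, e4, -⟩ | ⟨-, e2⟩
    swap
    · have := e2 (s (n + j)).1
      omega
    -- Inside block `b` each completed round has cost at least 1, and a positive-cost step beyond `p
    -- b` gives one more unit. Leaving requires passing `q b`, when the counter is `k`, so the total
    -- is at least `k + 1`.
    have key : ∀ j, (costBlock c M (s (n + j)).1 = b →
          ((s (n + j)).2 ≤ ∑ i ∈ Finset.range j, c (s (n + i)).1 ∧
          (Nat.count (fun i => 0 < c i) (p b) < Nat.count (fun i => 0 < c i) (s (n + j)).1 →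
            (s (n + j)).2 + 1 ≤ ∑ i ∈ Finset.range j, c (s (n + i)).1) ∧
          (q b ≤ (s (n + j)).1 → (s (n + j)).2 = k))) ∧
        (b < costBlock c M (s (n + j)).1 → k < ∑ i ∈ Finset.range j, c (s (n + i)).1) := by
      intro j
      induction j with
      | zero => simp [hbdef]
      | succ j ih =>
        obtain ⟨ih1, ih2⟩ := ih
        rw [Finset.sum_range_succ, ← Nat.add_assoc]
        set C := ∑ i ∈ Finset.range j, c (s (n + i)).1
        have hcount : Nat.count (fun i => 0 < c i) ((s (n + j)).1 + 1) ≤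
            Nat.count (fun i => 0 < c i) (s (n + j)).1 + c (s (n + j)).1 := by
          rw [Nat.count_succ]
          split_ifs <;> omega
        have hsucc := costBlock_succ_le c hM0 (s (n + j)).1
        have hle : costBlock c M (s (n + j)).1 ≤ costBlock c M ((s (n + j)).1 + 1) :=
          hmono (Nat.le_succ _)
        rcases hstep (n + j) with ⟨h1, h2, h3, h4, h5, h6, h7, h8, h9⟩ | ⟨h1, h2, h3, h4⟩
        · rw [h8, h9, h3]
          refine ⟨fun hb => ?_, fun hb => ?_⟩
          · have ⟨a1, a2, a3⟩ := ih1 hb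
            rw [hb] at h1 h6 ⊢
            refine ⟨?_, fun h => absurd h (lt_irrefl _), fun h => by omega⟩
            rcases Nat.lt_or_ge (Nat.count (fun i => 0 < c i) (p b))
              (Nat.count (fun i => 0 < c i) (s (n + j)).1) with h | h
            · have := a2 h
              omega
            · omega
          · have := ih2 hb
            omega
        · rw [h2]
          refine ⟨fun hb => ?_, fun hb => ?_⟩
          · by_cases hb' : costBlock c M (s (n + j)).1 = b
            · have ⟨a1, a2, a3⟩ := ih1 hb'
              rw [h3 (by omega)]
              rw [hb'] at h1
              refine ⟨by omega, fun h => ?_, fun h => ?_⟩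
              · rcases Nat.lt_or_ge (Nat.count (fun i => 0 < c i) (p b))
                  (Nat.count (fun i => 0 < c i) (s (n + j)).1) with h' | h'
                · have := a2 h'
                  omega
                · omega
              · rcases Nat.lt_or_ge (s (n + j)).1 (q b) with h' | h'
                · exact h1 (by omega)
                · exact a3 h'
            · rw [h4 (by omega)]
              have hpb : (s (n + j)).1 + 1 ≤ p b := by
                by_contra hlt
                have := hmono (show p b ≤ (s (n + j)).1 by omega)
                omega
              have := Nat.count_monotone (fun i => 0 < c i) hpb
              exact ⟨by omega, fun h => by omega, fun h => by omega⟩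
          · by_cases hb' : costBlock c M (s (n + j)).1 = b
            · have ⟨a1, a2, a3⟩ := ih1 hb'
              have hq : q b ≤ (s (n + j)).1 := by
                by_contra hlt
                have := hmono (show (s (n + j)).1 + 1 ≤ q b by omega)
                omega
              have := a3 hq
              have := a2 (lt_of_lt_of_le e4 (Nat.count_monotone _ hq))
              omega
            · have := ih2 (by omega)
              omega
    exact (key j).2 (by omega)

/-! ### One-step unfolding of the operators -/

namespace CPLTL

theorem self_mem_cl {P V : Type*} (φ : CPLTL P V) : φ ∈ φ.cl := by
  cases φ <;> simp [cl]

theorem varF_finite {P V : Type*} (φ : CPLTL P V) : φ.varF.Finite := by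
  refine (φ.cl_finite.biUnion (t := fun χ => {z | ∃ ψ, χ = evt z ψ}) fun χ _ => ?_).subset ?_
  · refine Set.Subsingleton.finite ?_
    rintro z ⟨ψ, rfl⟩ z' ⟨ψ', h⟩
    exact (CPLTL.evt.inj h).1
  · rintro z ⟨ψ, hψ⟩
    simp only [Set.mem_iUnion]
    exact ⟨_, hψ, ψ, rfl⟩

variable {P V : Type*} {κ : P} {w : CostTrace P κ} {α : V → ℕ} {n : ℕ} {φ ψ : CPLTL P V} {z : V}

theorem sat_untl_of_succ (h₁ : Sat w α n φ) (h₂ : Sat w α (n + 1) (untl φ ψ)) :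
    Sat w α n (untl φ ψ) := by
  obtain ⟨j, hj, hk⟩ := h₂
  refine ⟨j + 1, by rwa [add_assoc, add_comm 1] at hj, fun k hkj => ?_⟩
  cases k with
  | zero => exact h₁
  | succ k =>
    have := hk k (by omega)
    rwa [add_assoc, add_comm 1] at this

theorem sat_rel_of_succ (h₁ : Sat w α n ψ) (h₂ : Sat w α n φ ∨ Sat w α (n + 1) (rel φ ψ)) :
    Sat w α n (rel φ ψ) := by
  intro j
  cases j with
  | zero => exact Or.inl h₁
  | succ j =>
    rcases h₂ with h | h
    · exact Or.inr ⟨0, by omega, h⟩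
    · rcases h j with h | ⟨k, hk, h⟩
      · left
        rwa [add_assoc, add_comm 1] at h
      · right
        exact ⟨k + 1, by omega, by rwa [add_assoc, add_comm 1] at h⟩

theorem sat_right_of_sat_rel (h : Sat w α n (rel φ ψ)) : Sat w α n ψ := by
  simpa using h 0

theorem sat_rel_succ (h : Sat w α n (rel φ ψ)) (hφ : ¬ Sat w α n φ) :
    Sat w α (n + 1) (rel φ ψ) := by
  intro j
  rw [add_assoc, add_comm 1]
  rcases h (j + 1) with h | ⟨k, hk, h⟩
  · exact Or.inl h
  · right
    cases k with
    | zero => exact absurd h hφ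
    | succ k => exact ⟨k, by omega, by rwa [add_assoc, add_comm 1]⟩

theorem _root_.CostTrace.infixCost_succ' (w : CostTrace P κ) (n j : ℕ) :
    w.infixCost n (j + 1) = w.cost n + w.infixCost (n + 1) j := by
  unfold CostTrace.infixCost
  rw [Finset.sum_range_succ', add_comm]
  simp only [add_zero, add_assoc, add_comm 1]

/-- Unfolding of an always operator whose bound is zero. -/
theorem sat_alw_zero_of_succ (hz : α z = 0) (h₁ : Sat w α n φ)
    (h₂ : w.cost n = 0 → Sat w α (n + 1) (alw z φ)) : Sat w α n (alw z φ) := by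
  intro j hj
  cases j with
  | zero => exact h₁
  | succ j =>
    rw [w.infixCost_succ', hz] at hj
    have := h₂ (by omega) j (by omega)
    rwa [add_assoc, add_comm 1] at this

end CPLTL

/-! ### Costs within blocks and coverage by the walk -/

theorem CostTrace.infixCost_le {P : Type*} {κ : P} (w : CostTrace P κ) {W : ℕ}
    (hW : ∀ n, w.cost n ≤ W) (n j : ℕ) :
    w.infixCost n j + Nat.count (fun i => 0 < w.cost i) n * W ≤
      Nat.count (fun i => 0 < w.cost i) (n + j) * W := by
  unfold CostTrace.infixCost
  induction j with
  | zero => simp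
  | succ j ih =>
    rw [Finset.sum_range_succ, ← add_assoc, Nat.count_succ]
    have := hW (n + j)
    split_ifs with h
    · rw [Nat.add_mul]
      omega
    · rw [Nat.add_zero]
      omega

/-- Two consecutive blocks contain at most `2 * M` steps of positive cost. -/
theorem CostTrace.infixCost_le_of_costBlock_le {P : Type*} {κ : P} (w : CostTrace P κ) {W M : ℕ}
    (hM : 0 < M) (hW : ∀ n, w.cost n ≤ W) {n j : ℕ}
    (h : costBlock w.cost M (n + j) ≤ costBlock w.cost M n + 1) :
    w.infixCost n j ≤ 2 * M * W := by
  unfold costBlock at h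
  have h1 := w.infixCost_le hW n j
  set a := Nat.count (fun i => 0 < w.cost i) n
  set b := Nat.count (fun i => 0 < w.cost i) (n + j)
  have h2 : b ≤ a + 2 * M := by
    have h3 : b < (a / M + 2) * M := (Nat.div_lt_iff_lt_mul hM).1 (by omega)
    have h4 := Nat.div_mul_le_self a M
    rw [Nat.add_mul] at h3
    omega
  have := Nat.mul_le_mul_right W h2
  rw [Nat.add_mul] at this
  omega

/-- A discrete intermediate value argument: the walk may jump back but skips nothing going forward.
-/
theorem exists_eq_of_le {f : ℕ → ℕ} (hf : ∀ n, f (n + 1) ≤ f n + 1) (hu : ∀ B, ∃ n, B < f n)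
    {n m : ℕ} (h : f n ≤ m) : ∃ i, f (n + i) = m := by
  by_contra! hne
  have hlt : ∀ i, f (n + i) < m := by
    intro i
    induction i with
    | zero => exact lt_of_le_of_ne h (hne 0)
    | succ i ih => exact lt_of_le_of_ne ((hf (n + i)).trans ih) (hne (i + 1))
  obtain ⟨B, hB⟩ := ((Set.finite_Iic n).image f).bddAbove
  obtain ⟨y, hy⟩ := hu (max B m)
  rcases le_total y n with hyn | hyn
  · have := hB (Set.mem_image_of_mem f (show y ∈ Set.Iic n from hyn))
    omega
  · have := hlt (y - n)
    rw [Nat.add_sub_cancel' hyn] at this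
    omega

/-! ### Transfer from the pumped trace -/

/-- The truth value of a subformula at `n`, later in the block of `n`, and later in the block
of `n` or in the following one. -/
def satCode {P V : Type*} {κ : P} (w : CostTrace P κ) (β : V → ℕ) (block : ℕ → ℕ) (n : ℕ)
    (χ : CPLTL P V) (i : Fin 3) : Prop :=
  ![χ.Sat w β n, ∃ m, n ≤ m ∧ block m ≤ block n ∧ χ.Sat w β m,
    ∃ m, n ≤ m ∧ block m ≤ block n + 1 ∧ χ.Sat w β m] i

/-- Only one implication is needed because formulas are in negation normal form. -/
theorem sat_of_sat_pumped {P V : Type*} {κ : P} {w w' : CostTrace P κ} {α β : V → ℕ}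
    {f : ℕ → ℕ} {M k W : ℕ} {φ : CPLTL P V} (hM : 0 < M) (hW : ∀ n, w.cost n ≤ W)
    (hαk : ∀ z ∈ φ.varF, α z ≤ k) (hβF : ∀ z ∈ φ.varF, 2 * M * W ≤ β z)
    (hβG : ∀ z ∈ φ.varG, β z = 0)
    (hlabel : ∀ n, w'.label n = w.label (f n)) (hcost : ∀ n, w'.cost n = w.cost (f n))
    (hf : ∀ n, f (n + 1) ≤ f n + 1) (hu : ∀ B, ∃ n, B < f n)
    (hcode : ∀ n, ∀ χ ∈ φ.cl, satCode w β (costBlock w.cost M) (f (n + 1)) χ =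
      satCode w β (costBlock w.cost M) (f n + 1) χ)
    (hblock : ∀ n, costBlock w.cost M (f (n + 1)) = costBlock w.cost M (f n + 1))
    (hpump : ∀ n j, costBlock w.cost M (f n) + 2 ≤ costBlock w.cost M (f (n + j)) →
        k < ∑ i ∈ Finset.range j, w.cost (f (n + i)))
    (χ : CPLTL P V) (hχ : χ.cl ⊆ φ.cl) (n : ℕ) (h : χ.Sat w' α n) : χ.Sat w β (f n) := by
  have h0 : ∀ n, ∀ χ ∈ φ.cl, (χ.Sat w β (f (n + 1)) ↔ χ.Sat w β (f n + 1)) := fun n χ hχ =>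
    iff_of_eq (congrFun (hcode n χ hχ) 0)
  have hself := hχ χ.self_mem_cl
  induction χ generalizing n with
  | atom p => simpa [CPLTL.Sat, hlabel] using h
  | natom p => simpa [CPLTL.Sat, hlabel] using h
  | and a b iha ihb =>
    simp only [CPLTL.cl, Set.insert_subset_iff, Set.union_subset_iff] at hχ
    exact ⟨iha hχ.2.1 n h.1 (hχ.2.1 a.self_mem_cl), ihb hχ.2.2 n h.2 (hχ.2.2 b.self_mem_cl)⟩
  | or a b iha ihb =>
    simp only [CPLTL.cl, Set.insert_subset_iff, Set.union_subset_iff] at hχ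
    exact h.imp (fun h => iha hχ.2.1 n h (hχ.2.1 a.self_mem_cl))
      (fun h => ihb hχ.2.2 n h (hχ.2.2 b.self_mem_cl))
  | next a iha =>
    simp only [CPLTL.cl, Set.insert_subset_iff] at hχ
    have ha := hχ.2 a.self_mem_cl
    exact (h0 n a ha).1 (iha hχ.2 (n + 1) h ha)
  | untl a b iha ihb =>
    simp only [CPLTL.cl, Set.insert_subset_iff, Set.union_subset_iff] at hχ
    have ha := fun n h => iha hχ.2.1 n h (hχ.2.1 a.self_mem_cl)
    have hb := fun n h => ihb hχ.2.2 n h (hχ.2.2 b.self_mem_cl)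
    obtain ⟨j, hj, hk⟩ := h
    induction j generalizing n with
    | zero => exact ⟨0, hb _ hj, by simp⟩
    | succ j ih =>
      refine CPLTL.sat_untl_of_succ (ha n (hk 0 (by omega))) ((h0 n _ hself).1 (ih (n + 1) ?_ ?_))
      · rwa [add_assoc, add_comm 1]
      · intro i hi
        rw [add_assoc, add_comm 1]
        exact hk (i + 1) (by omega)
  | rel a b iha ihb =>
    simp only [CPLTL.cl, Set.insert_subset_iff, Set.union_subset_iff] at hχ
    have ha := fun n h => iha hχ.2.1 n h (hχ.2.1 a.self_mem_cl)
    have hb := fun n h => ihb hχ.2.2 n h (hχ.2.2 b.self_mem_cl)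
    by_contra hn
    -- A failure at `f n` would propagate along the whole walk, which covers every later position;
    -- then `b` holds at all of them, a contradiction.
    have key : ∀ i, (CPLTL.rel a b).Sat w' α (n + i) ∧ ¬ (CPLTL.rel a b).Sat w β (f (n + i)) := by
      intro i
      induction i with
      | zero => exact ⟨h, hn⟩
      | succ i ih =>
        obtain ⟨h1, h2⟩ := ih
        have h3 := hb _ (CPLTL.sat_right_of_sat_rel h1)
        refine ⟨CPLTL.sat_rel_succ h1 fun h4 => h2 ?_, fun h4 => h2 ?_⟩
        · exact CPLTL.sat_rel_of_succ h3 (Or.inl (ha _ h4))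
        · exact CPLTL.sat_rel_of_succ h3 (Or.inr ((h0 (n + i) _ hself).1 h4))
    refine hn fun j => Or.inl ?_
    obtain ⟨i, hi⟩ := exists_eq_of_le hf hu (Nat.le_add_right (f n) j)
    rw [← hi]
    exact hb _ (CPLTL.sat_right_of_sat_rel (key i).1)
  | evt z a iha =>
    simp only [CPLTL.cl, Set.insert_subset_iff] at hχ
    have ha := hχ.2 a.self_mem_cl
    obtain ⟨j, hj, hsat⟩ := h
    have hsat := iha hχ.2 _ hsat ha
    have hz : z ∈ φ.varF := ⟨a, hself⟩
    have hjb : costBlock w.cost M (f (n + j)) ≤ costBlock w.cost M (f n) + 1 := by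
      by_contra! hlt
      have h1 := hpump n j hlt
      have h2 := hαk z hz
      have h3 : w'.infixCost n j = ∑ i ∈ Finset.range j, w.cost (f (n + i)) :=
        Finset.sum_congr rfl fun i _ => hcost _
      omega
    have hmono := costBlock_mono w.cost M
    have hstep : ∀ n, costBlock w.cost M (f n) ≤ costBlock w.cost M (f (n + 1)) := fun n => by
      rw [hblock]
      exact hmono (Nat.le_succ _)
    have hfm : Monotone fun n => costBlock w.cost M (f n) := monotone_nat_of_le_succ hstep
    have key1 : ∀ j n, costBlock w.cost M (f (n + j)) ≤ costBlock w.cost M (f n) →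
        a.Sat w β (f (n + j)) → satCode w β (costBlock w.cost M) (f n) a 1 := by
      intro j
      induction j with
      | zero => exact fun n _ h => ⟨f n, le_rfl, le_rfl, h⟩
      | succ j ih =>
        intro n hle h
        rw [show n + (j + 1) = n + 1 + j by omega] at hle h
        have h1 := ih (n + 1) (hle.trans (hstep n)) h
        rw [hcode n a ha] at h1
        obtain ⟨m, hm, hbm, hsm⟩ := h1
        have h2 := hfm (Nat.le_add_right (n + 1) j)
        simp only [hblock n] at h2
        exact ⟨m, by omega, by omega, hsm⟩
    have key2 : ∀ j n, costBlock w.cost M (f (n + j)) ≤ costBlock w.cost M (f n) + 1 →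
        a.Sat w β (f (n + j)) → satCode w β (costBlock w.cost M) (f n) a 2 := by
      intro j
      induction j with
      | zero => exact fun n _ h => ⟨f n, le_rfl, Nat.le_succ _, h⟩
      | succ j ih =>
        intro n hle h
        rw [show n + (j + 1) = n + 1 + j by omega] at hle h
        have h1 := ih (n + 1) (hle.trans (Nat.succ_le_succ (hstep n))) h
        -- On entering the next block, the two-block window shrinks to that single block, so the
        -- second bit of the code takes over.
        by_cases hb : costBlock w.cost M (f (n + 1)) = costBlock w.cost M (f n)
        · rw [hcode n a ha] at h1
          obtain ⟨m, hm, hbm, hsm⟩ := h1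
          have h2 := hblock n
          exact ⟨m, by omega, by omega, hsm⟩
        · have h2 := hstep n
          have h3 := costBlock_succ_le w.cost hM (f n)
          have h1 := key1 j (n + 1) (by omega) h
          rw [hcode n a ha] at h1
          obtain ⟨m, hm, hbm, hsm⟩ := h1
          exact ⟨m, by omega, by omega, hsm⟩
    obtain ⟨m, hm, hbm, hsm⟩ := key2 j n hjb hsat
    obtain ⟨i, rfl⟩ := Nat.exists_eq_add_of_le hm
    exact ⟨i, (w.infixCost_le_of_costBlock_le hM hW hbm).trans (hβF z hz), hsm⟩
  | alw z a iha =>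
    simp only [CPLTL.cl, Set.insert_subset_iff] at hχ
    have ha := fun n h => iha hχ.2 n h (hχ.2 a.self_mem_cl)
    have hz : β z = 0 := hβG z ⟨a, hself⟩
    by_contra hn
    -- As for release; a failure with bound zero also forces every step to be free, so the
    -- hypothesis under `α` keeps applying.
    have key : ∀ i, w'.infixCost n i = 0 ∧ ¬ (CPLTL.alw z a).Sat w β (f (n + i)) := by
      intro i
      induction i with
      | zero => exact ⟨rfl, hn⟩
      | succ i ih =>
        obtain ⟨h1, h2⟩ := ih
        have h3 := ha _ (h i (by omega))
        constructor
        · rw [CostTrace.infixCost, Finset.sum_range_succ, ← CostTrace.infixCost, h1, hcost]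
          by_contra h4
          exact h2 (CPLTL.sat_alw_zero_of_succ hz h3 fun h5 => by omega)
        · exact fun h4 => h2 (CPLTL.sat_alw_zero_of_succ hz h3 fun _ => (h0 (n + i) _ hself).1 h4)
    refine hn fun j _ => ?_
    obtain ⟨i, hi⟩ := exists_eq_of_le hf hu (Nat.le_add_right (f n) j)
    rw [← hi]
    exact ha _ (h i (by have := (key i).1; omega))

/-! ### The bound -/

theorem mainTheorem8 :
    ∃ C : ℕ, ∀ (P V S : Type*) [Finite S] (κ : P) (T : TransitionSystem P κ S)
      (φ : CPLTL P V), φ.WellFormed →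
      (∃ α : V → ℕ, T.Satisfies φ α) →
      ∃ β : V → ℕ, (∀ z, β z ≤ 2 ^ (C * φ.size) * Nat.card S * T.maxCost) ∧
        T.Satisfies φ β := by
  classical
  refine ⟨5, fun P V S _ κ T φ hwf ⟨α, hα⟩ => ?_⟩
  set N := 2 ^ (5 * φ.size) * Nat.card S * T.maxCost with hN
  refine ⟨fun z => if z ∈ φ.varG then 0 else N, fun z => ?_, fun π => ?_⟩
  · beta_reduce
    split_ifs <;> omega
  set β : V → ℕ := fun z => if z ∈ φ.varG then 0 else N with hβ
  have : Finite φ.cl := φ.cl_finite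
  -- Three bits per subformula give the factor `8 ^ φ.size`; the factor 4 in `2 * M ≤ 4 * (Nat.card
  -- S * 8 ^ φ.size)` is absorbed by `4 ^ φ.size`, whence `C = 5`.
  set M := Nat.card S * 8 ^ φ.size + 1 with hMdef
  have hcard : Nat.card (S × (φ.cl → Fin 3 → Prop)) < M := by
    have : Nat.card (φ.cl → Fin 3 → Prop) = 8 ^ φ.size := by
      rw [Nat.card_fun, Nat.card_fun, Nat.card_coe_set_eq]
      simp [CPLTL.size]
    rw [Nat.card_prod, this]
    omega
  have hMN : 2 * M * T.maxCost ≤ N := by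
    refine Nat.mul_le_mul_right _ ?_
    have hS : 1 ≤ Nat.card S := Nat.card_pos_iff.2 ⟨⟨T.init⟩, inferInstance⟩
    have hs : 1 ≤ φ.size := (Set.ncard_pos φ.cl_finite).2 ⟨φ, φ.self_mem_cl⟩
    have h8 : 1 ≤ 8 ^ φ.size := Nat.one_le_pow _ _ (by norm_num)
    have h1 : 1 ≤ Nat.card S * 8 ^ φ.size := Nat.mul_pos hS h8
    have h4 : 4 ≤ 4 ^ φ.size := Nat.le_self_pow (by omega) 4
    calc 2 * M ≤ 4 * (Nat.card S * 8 ^ φ.size) := by omega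
      _ ≤ 4 ^ φ.size * (Nat.card S * 8 ^ φ.size) := Nat.mul_le_mul_right _ h4
      _ = 2 ^ (5 * φ.size) * Nat.card S := by
        rw [pow_mul, show 2 ^ 5 = 4 * 8 by norm_num, mul_pow]
        ring
  obtain ⟨k, hk⟩ := (φ.varF_finite.image α).bddAbove
  obtain ⟨f, hf0, hf, hcode, hblock, hu, hpump⟩ := exists_pumping π.trace.cost
    (fun n => ((π.state n, fun χ => satCode π.trace β (costBlock π.trace.cost M) n χ) :
      S × (φ.cl → Fin 3 → Prop))) hcard k
  have hstate : ∀ n, π.state (f (n + 1)) = π.state (f n + 1) := fun n =>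
    congrArg Prod.fst (hcode n)
  let π' : T.Path :=
    { state := fun n => π.state (f n)
      state_zero := by rw [hf0, π.state_zero]
      step := fun n => by rw [hstate]; exact π.step (f n) }
  have := sat_of_sat_pumped (w := π.trace) (w' := π'.trace) (α := α) (β := β) (f := f) (M := M)
    (k := k) (W := T.maxCost) (φ := φ) (by omega) (fun n => T.cost_le_maxCost _)
    (fun z hz => hk (Set.mem_image_of_mem α hz)) (fun z hz => ?_) (fun z hz => if_pos hz)
    (fun n => rfl) (fun n => ?_) hf hu
    (fun n χ hχ => congrFun (congrArg Prod.snd (hcode n)) ⟨χ, hχ⟩) hblock hpump φ subset_rfl 0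
    (hα π')
  · rwa [hf0] at this
  -- Well-formedness ensures that eventually variables were not set to zero.
  · have hzG : z ∉ φ.varG := fun h => by
      have : z ∈ φ.varF ∩ φ.varG := ⟨hz, h⟩
      rw [hwf] at this
      exact this
    rw [hβ]
    simpa only [if_neg hzG] using hMN
  · change T.cost _ = T.cost _
    congr 2
    exact Prod.ext rfl (hstate n)
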